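/- Throughout, an ideal on $\mathbb{N}$ is a family $\mathcal I\subseteq\mathcal P(\mathbb{N})$ closed under subsets and finite unions and containing all finite sets. It is \emph{tall} if every infinite $E\subseteq\mathbb{N}$ has an infinite subset belonging to $\mathcal I$. For a Banach space $X$, $\mathcal I$ is \emph{$\mathcal B$-representable in $X$} if there is a sequence $(x_n)_{n}$ in $X$ with $\mathcal I=\{M\subseteq\mathbb{N} : \sup_{F\subseteq M\text{ finite}}\|\sum_{n\in F}x_n\|<\infty\}$. A \emph{front} on $\mathbb{N}$ is a family $\mathcal G$ of finite subsets of $\mathbb{N}$ such that no element of $\mathcal G$ is a proper initial segment of another one and every infinite subset of $\mathbb{N}$ has an initial segment in $\mathcal G$. Given a coloring $c:\mathcal G\to\{0,\dots,r-1\}$ of a front, a set $A\subseteq\mathbb{N}$ is \emph{homogeneous} if, for some $i<r$, all $s\in\mathcal G$ with $s\subseteq A$ have color $i$. A \emph{c-coloring ideal} (or \emph{front ideal}) is the ideal generated by the homogeneous sets of such a coloring. A \emph{lower semicontinuous submeasure} is a function $\varphi:\mathcal P(\mathbb{N})\to[0,\infty]$ with $\varphi(\emptyset)=0$, $\varphi(A)\le\varphi(A\cup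 B)\le\varphi(A)+\varphi(B)$, $\varphi(\{n\})<\infty$ and $\varphi(A)=\lim_n\varphi(A\cap\{0,\dots,n\})$. An ideal is \emph{non-pathological} if it equals $\{A\subseteq\mathbb{N}:\varphi(A)<\infty\}$ for a lower semicontinuous submeasure $\varphi$ that is the pointwise supremum of all ($\sigma$-additive) measures on $\mathbb{N}$ dominated by $\varphi$. **Theorem.** Let $K$ be a countable compact Hausdorff space, let $C(K)$ be the Banach space of real-valued continuous functions on $K$ with the supremum norm, and let $\mathcal I$ be a tall ideal on $\mathbb{N}$ that is $\mathcal B$-representable in $C(K)$. Then $\mathcal I$ contains a non-pathological c-coloring ideal. Moreover, $\mathcal I$ admits a Borel selector: there is a Borel function $S:[\mathbb{N}]^\omega\to[\mathbb{N}]^\omega$ on the space of infinite subsets of $\mathbb{N}$ (with the topology inherited from $\{0,1\}^{\mathbb{N}}$) such that $S(E)\subseteq E$ and $S(E)\in\mathcal I$ for every infinite $E\subseteq\mathbb{N}$. -/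

import Mathlib

open Set Filter Topology MeasureTheory
open scoped ENNReal

noncomputable section

namespace CColoring

/-! Ideals on `ℕ`. -/

/-- An ideal on `ℕ`: a family of subsets of `ℕ` that is closed under subsets and finite unions
and contains all finite sets. The improper ideal of all subsets is allowed. -/
structure IsSetIdeal (I : Set (Set ℕ)) : Prop extends Order.IsIdeal I where
  finite_mem : ∀ A : Set ℕ, A.Finite → A ∈ I

/-- The smallest ideal on `ℕ` (containing all finite sets) that contains the family `𝒜`. -/
def generatedIdeal (𝒜 : Set (Set ℕ)) : Set (Set ℕ) :=
  {A | ∀ I : Set (Set ℕ), IsSetIdeal I → 𝒜 ⊆ I → A ∈ I}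

/-- A family is tall if every infinite subset of `ℕ` has an infinite subset in the family. -/
def IsTall (𝒜 : Set (Set ℕ)) : Prop :=
  ∀ E : Set ℕ, E.Infinite → ∃ A ⊆ E, A.Infinite ∧ A ∈ 𝒜

/-! Representation of ideals in Banach spaces. -/

/-- `𝓑(x)`: the sets `M` such that the norms of the sums of the `x n` over the finite subsets
of `M` are bounded. -/
def BIdeal {X : Type*} [NormedAddCommGroup X] (x : ℕ → X) : Set (Set ℕ) :=
  {M | ∃ C : ℝ, ∀ F : Finset ℕ, (F : Set ℕ) ⊆ M → ‖∑ n ∈ F, x n‖ ≤ C}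

/-- `I` is `𝓑`-representable in `X`. -/
def IsBRepresentable (X : Type*) [NormedAddCommGroup X] (I : Set (Set ℕ)) : Prop :=
  ∃ x : ℕ → X, I = BIdeal x

/-! Lower semicontinuous submeasures and non-pathological ideals. -/

/-- A lower semicontinuous submeasure on `ℕ`. -/
structure IsLSCSubmeasure (φ : Set ℕ → ℝ≥0∞) : Prop where
  empty : φ ∅ = 0
  mono : ∀ A B : Set ℕ, φ A ≤ φ (A ∪ B)
  union_le : ∀ A B : Set ℕ, φ (A ∪ B) ≤ φ A + φ B
  singleton_lt_top : ∀ n : ℕ, φ {n} < ∞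
  tendsto : ∀ A : Set ℕ, Tendsto (fun n : ℕ => φ (A ∩ Set.Iic n)) atTop (𝓝 (φ A))

/-- `φ` is the supremum of all the (countably additive) measures on `ℕ` dominated by `φ`. -/
def IsSupOfMeasures (φ : Set ℕ → ℝ≥0∞) : Prop :=
  ∀ A : Set ℕ, φ A = ⨆ (μ : Measure ℕ) (_ : ∀ B : Set ℕ, μ B ≤ φ B), μ A

/-- `Fin(φ)`: the sets of finite submeasure. -/
def finIdeal (φ : Set ℕ → ℝ≥0∞) : Set (Set ℕ) := {A | φ A < ∞}

/-- `I = Fin(φ)` for some non-pathological lower semicontinuous submeasure `φ`.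
(An ideal of the form `Fin(φ)` is automatically `F_σ`.) -/
def IsNonpathological (I : Set (Set ℕ)) : Prop :=
  ∃ φ : Set ℕ → ℝ≥0∞, IsLSCSubmeasure φ ∧ IsSupOfMeasures φ ∧ I = finIdeal φ

/-! Fronts, colorings of fronts, homogeneous sets. -/

/-- `s` is a (not necessarily proper) initial segment of `A`. -/
def IsInitialSegment (s : Finset ℕ) (A : Set ℕ) : Prop :=
  ∃ n : ℕ, (s : Set ℕ) = A ∩ Set.Iio n

/-- A front on `ℕ`: a family of finite sets, none of which is a proper initial segment of another,
such that every infinite subset of `ℕ` has an initial segment in the family. -/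
structure IsFront (G : Set (Finset ℕ)) : Prop where
  thin : ∀ s ∈ G, ∀ t ∈ G, IsInitialSegment s (t : Set ℕ) → s = t
  exists_initialSegment : ∀ A : Set ℕ, A.Infinite → ∃ s ∈ G, IsInitialSegment s A

/-- The sets `A` such that all members of `G` contained in `A` have color `i`. -/
def homOfColor {G : Set (Finset ℕ)} {r : ℕ} (c : G → Fin r) (i : Fin r) : Set (Set ℕ) :=
  {A | ∀ s : G, ((s : Finset ℕ) : Set ℕ) ⊆ A → c s = i}

/-- The homogeneous sets of `c`, of any color. -/
def hom {G : Set (Finset ℕ)} {r : ℕ} (c : G → Fin r) : Set (Set ℕ) :=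
  ⋃ i : Fin r, homOfColor c i

/-- A c-coloring (front) ideal: the ideal generated by the homogeneous sets of a coloring of a
front on `ℕ` with finitely many colors. -/
def IsCColoringIdeal (J : Set (Set ℕ)) : Prop :=
  ∃ (G : Set (Finset ℕ)) (r : ℕ) (c : G → Fin r), IsFront G ∧ J = generatedIdeal (hom c)

/-! Borel selectors. -/

/-- The space of infinite subsets of `ℕ`. -/
def InfSet : Type := {E : Set ℕ // E.Infinite}

/-- The characteristic function of an infinite subset of `ℕ`. -/
def InfSet.char (E : InfSet) : ℕ → Bool :=
  fun n => by classical exact decide (n ∈ E.1)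

/-- The topology inherited from the Cantor space `{0,1}^ℕ` via characteristic functions. -/
instance : TopologicalSpace InfSet := TopologicalSpace.induced InfSet.char inferInstance

instance : MeasurableSpace InfSet := borel InfSet

instance : BorelSpace InfSet := ⟨rfl⟩

/-- A Borel function that assigns to each infinite set `E` an infinite subset of `E` that belongs
to `𝒜`. -/
def HasBorelSelector (𝒜 : Set (Set ℕ)) : Prop :=
  ∃ S : InfSet → InfSet, Measurable S ∧ ∀ E : InfSet, (S E).1 ⊆ E.1 ∧ (S E).1 ∈ 𝒜

end CColoring

end

namespace CColoring

/-! Ideals of finite submeasure for suprema of measures. -/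

/-! Tallness forces `x n k → 0` for every `k`. Since `K` is countable, one level function `ℓ → ∞`
satisfies `|x n k| < 2⁻¹ ^ ℓ n` for almost all `n`, for each `k`. Let `φ` be the supremum of the
measures with weights `|x n k|` restricted to the finite sets where `2⁻¹ ^ ℓ n ≤ |x n k|`, and of
the counting measures on the fibers of `ℓ`. If `φ A < ∞`, the terms below threshold sum
geometrically, so `A ∈ BIdeal x`; passing to sets with `ℓ` injective shows that `finIdeal φ` is
still tall.

Truncation makes the carriers finite and, by compactness of `K`, every infinite set has a finite
subset contained in no carrier (`levelSets_compact`). Hence the minimal finite sets whose tail lies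
in no carrier form a front. Coloring `s` by whether `φ s ≤ min s`, the homogeneous sets generate
exactly `finIdeal φ` (`isCColoringIdeal_finIdeal`).

The Borel selector comes from a Borel Nash-Williams argument: well-founded induction along the front
with a measurable diagonalization at each stage. -/

theorem isLSCSubmeasure_iSup_measure {ι : Type*} (μ : ι → Measure ℕ)
    (h : ∀ n : ℕ, ⨆ i, μ i {n} < ∞) : IsLSCSubmeasure (fun A => ⨆ i, μ i A) where
  empty := by simp
  mono A B := iSup_mono fun i => measure_mono subset_union_left
  union_le A B := iSup_le fun i => (measure_union_le A B).trans
    (add_le_add (le_iSup (fun i => μ i A) i) (le_iSup (fun i => μ i B) i))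
  singleton_lt_top := h
  tendsto A := by
    have hm : Monotone fun n : ℕ => A ∩ Set.Iic n := fun m n hmn =>
      inter_subset_inter_right A (Iic_subset_Iic.2 hmn)
    have hA : A = ⋃ n : ℕ, A ∩ Set.Iic n := by
      rw [← inter_iUnion, iUnion_Iic, inter_univ]
    have hsup : ⨆ i, μ i A = ⨆ n : ℕ, ⨆ i, μ i (A ∩ Set.Iic n) := by
      rw [iSup_comm]
      refine iSup_congr fun i => ?_
      conv_lhs => rw [hA]
      exact hm.measure_iUnion
    rw [hsup]
    exact tendsto_atTop_iSup fun m n hmn => iSup_mono fun i => measure_mono (hm hmn)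

theorem isSupOfMeasures_iSup_measure {ι : Type*} (μ : ι → Measure ℕ) :
    IsSupOfMeasures (fun A => ⨆ i, μ i A) := fun A =>
  le_antisymm
    (iSup_le fun i => le_iSup₂_of_le (μ i) (fun B => le_iSup (fun i => μ i B) i) le_rfl)
    (iSup₂_le fun _ hν => hν A)

theorem IsLSCSubmeasure.le_of_subset {φ : Set ℕ → ℝ≥0∞} (hφ : IsLSCSubmeasure φ)
    {A B : Set ℕ} (h : A ⊆ B) : φ A ≤ φ B := by
  have := hφ.mono A B
  rwa [union_eq_self_of_subset_left h] at this

theorem IsLSCSubmeasure.isSetIdeal_finIdeal {φ : Set ℕ → ℝ≥0∞} (hφ : IsLSCSubmeasure φ) :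
    IsSetIdeal (finIdeal φ) where
  IsLowerSet := fun _ _ hBA hA => (hφ.le_of_subset hBA).trans_lt hA
  Nonempty := ⟨∅, by simp [finIdeal, hφ.empty]⟩
  Directed := fun A hA B hB => ⟨A ∪ B,
    (hφ.union_le A B).trans_lt (ENNReal.add_lt_top.2 ⟨hA, hB⟩), subset_union_left,
    subset_union_right⟩
  finite_mem := fun A hA => by
    induction A, hA using Set.Finite.induction_on with
    | empty => simp [finIdeal, hφ.empty]
    | insert _ _ ih =>
      rw [Set.insert_eq]
      exact (hφ.union_le _ _).trans_lt (ENNReal.add_lt_top.2 ⟨hφ.singleton_lt_top _, ih⟩)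

theorem IsSetIdeal.union_mem {I : Set (Set ℕ)} (hI : IsSetIdeal I) {A B : Set ℕ} (hA : A ∈ I)
    (hB : B ∈ I) : A ∪ B ∈ I := by
  obtain ⟨C, hC, hAC, hBC⟩ := hI.Directed A hA B hB
  exact hI.IsLowerSet (union_subset hAC hBC) hC

theorem subset_generatedIdeal (𝒜 : Set (Set ℕ)) : 𝒜 ⊆ generatedIdeal 𝒜 :=
  fun _ hA _ _ h => h hA

/-! Fronts. -/

/-- The minimal finite sets violating `P`, in the order of initial segments. -/
def minimalViolations (P : Finset ℕ → Prop) : Set (Finset ℕ) :=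
  {s | ¬ P s ∧ ∀ n ∈ s, P (s.filter (· < n))}

/-- If `s` were a proper initial segment of `t`, cutting `t` at its first element outside `s` would
give `s`, so minimality of `t` would yield `P s`. The shortest violating segment of an infinite set
is minimal. -/
theorem isFront_minimalViolations {P : Finset ℕ → Prop}
    (hP : ∀ A : Set ℕ, A.Infinite → ∃ s : Finset ℕ, IsInitialSegment s A ∧ ¬ P s) :
    IsFront (minimalViolations P) where
  thin := by
    rintro s hs t ht ⟨n, hn⟩
    have hmem : ∀ a, a ∈ s ↔ a ∈ t ∧ a < n := fun a => by
      have := Set.ext_iff.1 hn a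
      simpa using this
    by_contra hne
    have hex : ∃ a, a ∈ t ∧ n ≤ a := by
      by_contra! h
      exact hne (Finset.ext fun a => ⟨fun ha => ((hmem a).1 ha).1, fun ha => (hmem a).2 ⟨ha, h a ha⟩⟩)
    classical
    have hspec := Nat.find_spec hex
    have : s = t.filter (· < Nat.find hex) := by
      ext a
      rw [hmem, Finset.mem_filter]
      refine and_congr_right fun ha => ⟨fun h => h.trans_le hspec.2, fun h => ?_⟩
      by_contra! hna
      exact Nat.find_min hex h ⟨ha, hna⟩
    exact hs.1 (this ▸ ht.2 _ hspec.1)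
  exists_initialSegment := by
    intro A hA
    classical
    let seg : ℕ → Finset ℕ := fun n => (Finset.range n).filter (· ∈ A)
    have hseg : ∀ n, (seg n : Set ℕ) = A ∩ Set.Iio n := fun n => by
      ext a; simp [seg, and_comm]
    have hex : ∃ n, ¬ P (seg n) := by
      obtain ⟨s, ⟨n, hn⟩, hs⟩ := hP A hA
      refine ⟨n, ?_⟩
      rwa [← show s = seg n from Finset.coe_injective (hn.trans (hseg n).symm)]
    refine ⟨seg (Nat.find hex), ⟨Nat.find_spec hex, fun m hm => ?_⟩, Nat.find hex, hseg _⟩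
    have hmn : m < Nat.find hex := by simp [seg] at hm; simpa using hm.1
    have : (seg (Nat.find hex)).filter (· < m) = seg m := by
      ext a
      simp only [seg, Finset.mem_filter, Finset.mem_range]
      exact ⟨fun h => ⟨h.2, h.1.2⟩, fun h => ⟨⟨h.1.trans hmn, h.2⟩, h.1⟩⟩
    rw [this]
    exact not_not.1 (Nat.find_min hex hmn)

/-- Up to its least element, `t` is contained in a member of the family `T`. -/
def TailSubset {ι : Type*} (T : ι → Set ℕ) (t : Finset ℕ) : Prop :=
  ∃ i, ∀ a ∈ t, (∃ b ∈ t, b < a) → a ∈ T i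

theorem TailSubset.mono {ι : Type*} {T : ι → Set ℕ} {s t : Finset ℕ} (ht : TailSubset T t)
    (hst : s ⊆ t) : TailSubset T s := by
  obtain ⟨i, hi⟩ := ht
  exact ⟨i, fun a ha ⟨b, hb, hba⟩ => hi a (hst ha) ⟨b, hst hb, hba⟩⟩

/-- Set aside one `m ∈ A` and take a bad finite set `F` above it; the segment of `A` through `F` has
`F` in its tail. -/
theorem isFront_of_compact {ι : Type*} {T : ι → Set ℕ}
    (hT : ∀ A : Set ℕ, A.Infinite → ∃ F : Finset ℕ, (F : Set ℕ) ⊆ A ∧ ∀ i, ¬ (F : Set ℕ) ⊆ T i) :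
    IsFront (minimalViolations (TailSubset T)) := by
  refine isFront_minimalViolations fun A hA => ?_
  classical
  obtain ⟨m, hm⟩ := hA.nonempty
  obtain ⟨F, hF, hFT⟩ := hT (A \ Set.Iic m) (hA.sdiff (Set.finite_Iic m))
  refine ⟨(Finset.range (F.sup id + m + 1)).filter (· ∈ A), ⟨F.sup id + m + 1, ?_⟩, ?_⟩
  · ext a; simp [and_comm]
  · rintro ⟨i, hi⟩
    refine hFT i fun a ha => ?_
    have ha' := hF ha
    have hle : a ≤ F.sup id := Finset.le_sup (f := id) ha
    simp only [Finset.mem_filter, Finset.mem_range] at hi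
    refine hi a ⟨by omega, ha'.1⟩ ⟨m, ⟨by omega, hm⟩, ?_⟩
    simpa using ha'.2

/-- A tall ideal of finite submeasure for a supremum of measures that are carried by a
precompact family of finite sets is a front ideal. -/
theorem isCColoringIdeal_finIdeal {ι : Type*} {T : ι → Set ℕ} {μ : ι → Measure ℕ}
    (hT : ∀ A : Set ℕ, A.Infinite → ∃ F : Finset ℕ, (F : Set ℕ) ⊆ A ∧ ∀ i, ¬ (F : Set ℕ) ⊆ T i)
    (hμ : ∀ i, μ i (T i)ᶜ = 0) (hsing : ∀ n : ℕ, ⨆ i, μ i {n} < ∞)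
    (htall : IsTall (finIdeal fun A => ⨆ i, μ i A)) :
    IsCColoringIdeal (finIdeal fun A => ⨆ i, μ i A) := by
  classical
  have hfront := isFront_of_compact hT
  have hlsc := isLSCSubmeasure_iSup_measure μ hsing
  set φ : Set ℕ → ℝ≥0∞ := fun A => ⨆ i, μ i A with hφ
  set G := minimalViolations (TailSubset T)
  -- For nonempty `s` color `0` means `φ s ≤ min s`.
  let c : G → Fin 2 := fun s => if ∀ n ∈ (s : Finset ℕ), φ (s : Finset ℕ) ≤ n then 0 else 1
  have hc : ∀ s : G, c s = 0 ↔ ∀ n ∈ (s : Finset ℕ), φ (s : Finset ℕ) ≤ n := fun s => by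
    simp [c]
  have hTfin : ∀ i, (T i).Finite := fun i => by
    by_contra h
    obtain ⟨F, hF, hF'⟩ := hT (T i) h
    exact hF' i hF
  refine ⟨G, 2, c, hfront, Set.Subset.antisymm ?_ fun A hA => hA _ hlsc.isSetIdeal_finIdeal ?_⟩
  · intro A hA I hI hhom
    obtain ⟨C, hC⟩ := ENNReal.exists_nat_gt (ne_of_lt hA)
    have h1 : A ∩ Set.Iio C ∈ I := hI.finite_mem _ ((Set.finite_Iio C).inter_of_right A)
    have h2 : A \ Set.Iio C ∈ I := hhom <| Set.mem_iUnion.2 ⟨0, fun s hs => (hc s).2 fun n hn => by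
      have hn' : C ≤ n := by simpa using (hs hn).2
      calc φ (s : Finset ℕ) ≤ φ A := hlsc.le_of_subset (hs.trans sdiff_subset)
        _ ≤ C := hC.le
        _ ≤ n := by exact_mod_cast hn'⟩
    have := hI.union_mem h1 h2
    rwa [inter_union_sdiff] at this
  · intro A hA
    obtain ⟨color, hA⟩ := Set.mem_iUnion.1 hA
    by_cases hfin : A.Finite
    · exact hlsc.isSetIdeal_finIdeal.finite_mem A hfin
    have hinf : A.Infinite := hfin
    -- By tallness `A` contains an infinite `B` with `φ B ≤ C`; a front member inside `B` beyond `C`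
    -- has color `0`.
    have hcol : color = 0 := by
      obtain ⟨B, hBA, hB, hφB⟩ := htall A hinf
      obtain ⟨C, hC⟩ := ENNReal.exists_nat_gt (ne_of_lt hφB)
      obtain ⟨s, hs, n, hsn⟩ := hfront.exists_initialSegment (B \ Set.Iio C)
        (hB.sdiff (Set.finite_Iio C))
      have hsB : (s : Set ℕ) ⊆ B \ Set.Iio C := hsn ▸ inter_subset_left
      have h1 : c ⟨s, hs⟩ = color := hA ⟨s, hs⟩ ((hsB.trans sdiff_subset).trans hBA)
      rw [← h1, hc]
      intro n hn
      have hn' : C ≤ n := by simpa using (hsB hn).2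
      calc φ s ≤ φ B := hlsc.le_of_subset (hsB.trans sdiff_subset)
        _ ≤ C := hC.le
        _ ≤ n := by exact_mod_cast hn'
    subst hcol
    have hex : ∃ a, a ∈ A := hinf.nonempty
    set a := Nat.find hex
    have haA : a ∈ A := Nat.find_spec hex
    refine lt_of_le_of_lt (iSup_le fun i => ?_) (ENNReal.natCast_lt_top a)
    -- All of `A` that `μ i` sees, with `min A` added: the exempt least element in `TailSubset`.
    let t : Finset ℕ := insert a ((hTfin i).inter_of_right A).toFinset
    have htA : (t : Set ℕ) ⊆ A := by
      intro b hb
      simp only [t, Finset.coe_insert, Set.Finite.coe_toFinset, Set.mem_insert_iff] at hb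
      rcases hb with rfl | hb
      · exact haA
      · exact hb.1
    have htT : TailSubset T t := by
      refine ⟨i, fun b hb ⟨b', hb', hlt⟩ => ?_⟩
      simp only [t, Finset.mem_insert, Set.Finite.mem_toFinset] at hb
      rcases hb with rfl | hb
      · exact absurd (htA hb') (Nat.find_min hex hlt)
      · exact hb.2
    obtain ⟨s, hs, n, hsn⟩ := hfront.exists_initialSegment
      ((t : Set ℕ) ∪ (A \ Set.Iic (t.sup id)))
      ((hinf.sdiff (Set.finite_Iic _)).mono subset_union_right)
    -- Otherwise the segment `s` stops inside `t`, so it inherits `TailSubset` and violates nothing.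
    have hts : t ⊆ s := by
      by_contra hnot
      obtain ⟨x, hxt, hxs⟩ := Finset.not_subset.1 hnot
      refine hs.1 (htT.mono fun y hy => ?_)
      have hnx : n ≤ x := by
        by_contra! h
        exact hxs (by rw [← Finset.mem_coe, hsn]; exact ⟨Or.inl hxt, h⟩)
      have hxsup : x ≤ t.sup id := Finset.le_sup (f := id) hxt
      have hy' : y ∈ ((t : Set ℕ) ∪ (A \ Set.Iic (t.sup id))) ∩ Set.Iio n := hsn ▸ hy
      rcases hy'.1 with h | h
      · exact h
      · have h1 : y < n := hy'.2
        have h2 : ¬ y ≤ t.sup id := h.2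
        omega
    have hsA : (s : Set ℕ) ⊆ A := by
      rw [hsn]
      exact inter_subset_left.trans (union_subset htA sdiff_subset)
    have key := (hc ⟨s, hs⟩).1 (hA ⟨s, hs⟩ hsA) a (hts (Finset.mem_insert_self _ _))
    have hAt : A ⊆ (t : Set ℕ) ∪ (T i)ᶜ := fun b hb => by
      by_cases hbT : b ∈ T i
      · left; simp [t, hb, hbT]
      · exact Or.inr hbT
    calc μ i A ≤ μ i ((t : Set ℕ) ∪ (T i)ᶜ) := measure_mono hAt
      _ ≤ μ i t + μ i (T i)ᶜ := measure_union_le _ _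
      _ = μ i t := by rw [hμ, add_zero]
      _ ≤ φ t := le_iSup (fun i => μ i t) i
      _ ≤ φ s := hlsc.le_of_subset (Finset.coe_subset.2 hts)
      _ ≤ a := key

/-! Borel selectors for fronts. -/

theorem InfSet.measurableSet_mem (m : ℕ) : MeasurableSet {E : InfSet | m ∈ E.1} := by
  have hcont : Continuous InfSet.char := continuous_induced_dom
  have : {E : InfSet | m ∈ E.1} = (fun E => InfSet.char E m) ⁻¹' {true} := by
    ext E; simp [InfSet.char]
  rw [this]
  exact ((continuous_apply m).comp hcont).measurable (measurableSet_singleton true)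

theorem InfSet.measurable_iff {α : Type*} [MeasurableSpace α] {f : α → InfSet} :
    Measurable f ↔ ∀ m : ℕ, MeasurableSet {a | m ∈ (f a).1} := by
  refine ⟨fun hf m => hf (InfSet.measurableSet_mem m), fun h => ?_⟩
  have hborel : borel InfSet = MeasurableSpace.comap InfSet.char inferInstance := by
    rw [BorelSpace.measurable_eq (α := ℕ → Bool)]
    exact borel_comap
  have : Measurable (InfSet.char ∘ f) := by
    refine measurable_pi_iff.2 fun m => measurable_to_bool ?_
    have : (fun a => (InfSet.char ∘ f) a m) ⁻¹' {true} = {a | m ∈ (f a).1} := by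
      ext a; simp [InfSet.char]
    rw [this]
    exact h m
  rw [measurable_iff_comap_le, BorelSpace.measurable_eq (α := InfSet), hborel, MeasurableSpace.comap_comp]
  exact this.comap_le

/-- The least element. -/
noncomputable def InfSet.min (E : InfSet) : ℕ := sInf E.1

theorem InfSet.min_mem (E : InfSet) : E.min ∈ E.1 := Nat.sInf_mem E.2.nonempty

theorem InfSet.min_le (E : InfSet) {m : ℕ} (hm : m ∈ E.1) : E.min ≤ m := Nat.sInf_le hm

/-- The set without its least element. -/
noncomputable def InfSet.tail (E : InfSet) : InfSet := ⟨E.1 \ {E.min}, E.2.sdiff (Set.finite_singleton _)⟩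

theorem InfSet.measurable_min : Measurable InfSet.min := by
  refine measurable_to_countable' fun n => ?_
  have : InfSet.min ⁻¹' {n} = {E | n ∈ E.1} ∩ ⋂ m ∈ Set.Iio n, {E : InfSet | m ∈ E.1}ᶜ := by
    ext E
    simp only [Set.mem_preimage, Set.mem_singleton_iff, Set.mem_inter_iff, Set.mem_ofPred_eq,
      Set.mem_iInter, Set.mem_Iio, Set.mem_compl_iff]
    constructor
    · rintro rfl
      exact ⟨E.min_mem, fun m hm hmE => (E.min_le hmE).not_gt hm⟩
    · rintro ⟨hn, h⟩
      exact (E.min_le hn).antisymm (not_lt.1 fun hlt => h _ hlt E.min_mem)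
  rw [this]
  exact (InfSet.measurableSet_mem n).inter (MeasurableSet.biInter (Set.to_countable _)
    fun m _ => (InfSet.measurableSet_mem m).compl)

theorem InfSet.measurable_tail : Measurable InfSet.tail :=
  InfSet.measurable_iff.2 fun m => by
    have : {E : InfSet | m ∈ E.tail.1} = {E | m ∈ E.1} ∩ (InfSet.min ⁻¹' {m})ᶜ := by
      ext E; simp [InfSet.tail, eq_comm]
    rw [this]
    exact (InfSet.measurableSet_mem m).inter
      (InfSet.measurable_min (measurableSet_singleton m)).compl

/-- Diagonalization of Borel selectors `S n` with colors `κ n`: a Borel selector such that, for each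
of its elements `n`, the later elements lie in a value of `S n`, of a color not depending on `n`. -/
theorem exists_measurable_diagonal {r : ℕ} (S : ℕ → InfSet → InfSet) (κ : ℕ → InfSet → Fin r)
    (hS : ∀ n, Measurable (S n)) (hκ : ∀ n, Measurable (κ n)) (hsub : ∀ n E, (S n E).1 ⊆ E.1) :
    ∃ (S' : InfSet → InfSet) (κ' : InfSet → Fin r), Measurable S' ∧ Measurable κ' ∧
      ∀ E, (S' E).1 ⊆ E.1 ∧ ∀ n ∈ (S' E).1, ∃ E' : InfSet, κ n E' = κ' E ∧
        (S' E).1 ∩ Set.Ioi n ⊆ (S n E').1 := by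
  classical
  -- The minima of the iterates increase strictly and form the pool for `S'`, thinned to those whose
  -- color is a recurrent one.
  let next : InfSet → InfSet := fun E => S E.min E.tail
  let it : ℕ → InfSet → InfSet := fun i E => next^[i] E
  let col : ℕ → InfSet → Fin r := fun i E => κ (it i E).min (it i E).tail
  have hnext : Measurable next :=
    (measurable_from_prod_countable_right (f := fun p : ℕ × InfSet => S p.1 p.2) hS).comp
      (InfSet.measurable_min.prodMk InfSet.measurable_tail)
  have hit : ∀ i, Measurable (it i) := fun i => hnext.iterate i
  have hmin : ∀ i, Measurable fun E => (it i E).min := fun i => InfSet.measurable_min.comp (hit i)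
  have hcol : ∀ i, Measurable (col i) := fun i =>
    (measurable_from_prod_countable_right (f := fun p : ℕ × InfSet => κ p.1 p.2) hκ).comp
      ((hmin i).prodMk (InfSet.measurable_tail.comp (hit i)))
  have hsucc : ∀ i E, it (i + 1) E = S (it i E).min (it i E).tail := fun i E =>
    Function.iterate_succ_apply' next i E
  have hstep : ∀ i E, (it (i + 1) E).1 ⊆ (it i E).tail.1 := fun i E => by
    rw [hsucc]; exact hsub _ _
  have hanti : ∀ E, Antitone fun i => (it i E).1 := fun E =>
    antitone_nat_of_succ_le fun i => (hstep i E).trans sdiff_subset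
  have hmono : ∀ E, StrictMono fun i => (it i E).min := fun E =>
    strictMono_nat_of_lt_succ fun i => by
      have h := hstep i E (it (i + 1) E).min_mem
      exact lt_of_le_of_ne ((it i E).min_le h.1) fun h' => h.2 h'.symm
  have hex : ∀ E, ∃ k : ℕ, ∃ h : k < r, ∀ N, ∃ i ≥ N, col i E = ⟨k, h⟩ := fun E => by
    obtain ⟨k, hk⟩ := Finite.exists_infinite_fiber fun i => col i E
    refine ⟨k, k.2, fun N => ?_⟩
    obtain ⟨i, hi, hiN⟩ := (Set.infinite_coe_iff.1 hk).exists_gt N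
    exact ⟨i, hiN.le, hi⟩
  have hmeas : ∀ k : ℕ, MeasurableSet {E | ∃ h : k < r, ∀ N, ∃ i ≥ N, col i E = ⟨k, h⟩} := by
    intro k
    by_cases h : k < r
    · have : {E | ∃ h : k < r, ∀ N, ∃ i ≥ N, col i E = ⟨k, h⟩} =
          ⋂ N, ⋃ i ∈ Set.Ici N, col i ⁻¹' {⟨k, h⟩} := by
        ext E; simp [h]
      rw [this]
      exact MeasurableSet.iInter fun N => MeasurableSet.biUnion (Set.to_countable _)
        fun i _ => hcol i (measurableSet_singleton _)
    · simp [h]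
  -- Taking the least recurrent color keeps the choice measurable.
  let κ' : InfSet → Fin r := fun E => ⟨Nat.find (hex E), (Nat.find_spec (hex E)).1⟩
  have hκ'spec : ∀ E N, ∃ i ≥ N, col i E = κ' E := fun E => (Nat.find_spec (hex E)).2
  have hκ' : Measurable κ' := by
    refine measurable_to_countable' fun k => ?_
    have : κ' ⁻¹' {k} = (fun E => Nat.find (hex E)) ⁻¹' {(k : ℕ)} := by
      ext E; simp [κ', Fin.ext_iff]
    rw [this]
    exact measurable_find hex hmeas (measurableSet_singleton _)
  let S' : InfSet → InfSet := fun E => ⟨{m | ∃ i, (it i E).min = m ∧ col i E = κ' E}, by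
    refine Set.infinite_of_not_bddAbove fun ⟨b, hb⟩ => ?_
    obtain ⟨i, hi, hcoli⟩ := hκ'spec E (b + 1)
    have h1 : (it i E).min ≤ b := hb ⟨i, rfl, hcoli⟩
    have h2 : i ≤ (it i E).min := (hmono E).le_apply
    omega⟩
  refine ⟨S', κ', InfSet.measurable_iff.2 fun m => ?_, hκ', fun E => ⟨?_, ?_⟩⟩
  · have : {E | m ∈ (S' E).1} =
        ⋃ i, (fun E => (it i E).min) ⁻¹' {m} ∩ {E | col i E = κ' E} := by
      ext E; simp [S']
    rw [this]
    exact MeasurableSet.iUnion fun i => (hmin i (measurableSet_singleton m)).inter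
      (measurableSet_eq_fun (hcol i) hκ')
  · rintro m ⟨i, rfl, -⟩
    exact hanti E (Nat.zero_le i) (it i E).min_mem
  · rintro n ⟨i, rfl, hi⟩
    refine ⟨(it i E).tail, hi, ?_⟩
    rintro m ⟨⟨j, rfl, -⟩, hj⟩
    have hij : i < j := (hmono E).lt_iff_lt.1 hj
    rw [← hsucc]
    exact hanti E (Nat.succ_le_of_lt hij) (it j E).min_mem

/-- `t` extends `s` by one larger element, and `s` has no initial segment in `G`. -/
def FrontStep (G : Set (Finset ℕ)) (t s : Finset ℕ) : Prop :=
  (∃ n, (∀ a ∈ s, a < n) ∧ t = insert n s) ∧ ¬ ∃ g ∈ G, IsInitialSegment g (s : Set ℕ)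

/-- The union of an infinite chain is an infinite set with a segment in `G` below some `m`. As `m ≤
n m`, stage `m` already contains that segment. -/
theorem IsFront.wellFounded_frontStep {G : Set (Finset ℕ)} (hG : IsFront G) :
    WellFounded (FrontStep G) := by
  rw [wellFounded_iff_isEmpty_descending_chain]
  refine ⟨fun ⟨s, hs⟩ => ?_⟩
  choose n hn hins using fun k => (hs k).1
  have hmono : Monotone s := monotone_nat_of_le_succ fun k => by
    rw [hins]; exact Finset.subset_insert _ _
  have hmem : ∀ k, n k ∈ s (k + 1) := fun k => by
    rw [hins]; exact Finset.mem_insert_self _ _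
  have hnmono : StrictMono n := strictMono_nat_of_lt_succ fun k => hn _ _ (hmem k)
  have hlate : ∀ j k, j ≤ k → ∀ a ∈ s k, a ∈ s j ∨ n j ≤ a := fun j k hjk => by
    induction k, hjk using Nat.le_induction with
    | base => exact fun a ha => Or.inl ha
    | succ k hk ih =>
      intro a ha
      rw [hins, Finset.mem_insert] at ha
      rcases ha with rfl | ha
      · exact Or.inr (hnmono.monotone hk)
      · exact ih a ha
  have hinf : (⋃ k, (s k : Set ℕ)).Infinite :=
    (Set.infinite_range_of_injective hnmono.injective).mono <| by
      rintro _ ⟨k, rfl⟩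
      exact Set.mem_iUnion.2 ⟨k + 1, hmem k⟩
  obtain ⟨g, hg, m, hgm⟩ := hG.exists_initialSegment _ hinf
  refine (hs m).2 ⟨g, hg, m, hgm.trans ?_⟩
  ext a
  simp only [Set.mem_inter_iff, Set.mem_iUnion, Finset.mem_coe, Set.mem_Iio]
  refine and_congr_left fun ham => ⟨fun ⟨k, hk⟩ => ?_, fun h => ⟨m, h⟩⟩
  rcases le_total m k with h | h
  · rcases hlate m k h a hk with h' | h'
    · exact h'
    · have : m ≤ n m := hnmono.le_apply
      omega
  · exact hmono h hk

/-- Nash-Williams relative to a stem `s`. Once `s` has a segment in `G`, thinness leaves only one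
possible `u`; otherwise the selectors for the stems `insert n s` are diagonalized. -/
theorem IsFront.exists_measurable_homogeneous {G : Set (Finset ℕ)} (hG : IsFront G) {r : ℕ}
    (c : G → Fin r) (s : Finset ℕ) :
    ∃ (S : InfSet → InfSet) (κ : InfSet → Fin r), Measurable S ∧ Measurable κ ∧
      ∀ E, (S E).1 ⊆ E.1 ∧ ∀ u : G, s ⊆ u → (∀ a ∈ (u : Finset ℕ), a ∉ s →
        (∀ b ∈ s, b < a) ∧ a ∈ (S E).1) → c u = κ E := by
  classical
  induction s using hG.wellFounded_frontStep.induction with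
  | _ s ih =>
  by_cases hs : ∃ g ∈ G, IsInitialSegment g (s : Set ℕ)
  · obtain ⟨g, hg, n, hn⟩ := hs
    refine ⟨id, fun _ => c ⟨g, hg⟩, measurable_id, measurable_const,
      fun E => ⟨Subset.rfl, fun u hsu hu => ?_⟩⟩
    have hgs : ∀ a, a ∈ g ↔ a ∈ s ∧ a < n := fun a => by
      have := Set.ext_iff.1 hn a
      simpa using this
    have hgu : g = u := by
      refine hG.thin g hg u u.2 ⟨g.sup Nat.succ, ?_⟩
      ext a
      simp only [Finset.mem_coe, Set.mem_inter_iff, Set.mem_Iio, Finset.lt_sup_iff]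
      refine ⟨fun ha => ⟨hsu ((hgs a).1 ha).1, a, ha, a.lt_succ_self⟩, fun ⟨ha, b, hb, hab⟩ => ?_⟩
      have hbs := (hgs b).1 hb
      have has : a ∈ s := by
        by_contra has
        exact ((hu a ha has).1 b hbs.1).not_ge (Nat.lt_succ_iff.1 hab)
      exact (hgs a).2 ⟨has, (Nat.lt_succ_iff.1 hab).trans_lt hbs.2⟩
    exact congrArg c (Subtype.ext hgu.symm)
  · have ih' : ∀ n, ∃ (S : InfSet → InfSet) (κ : InfSet → Fin r), Measurable S ∧ Measurable κ ∧
        ∀ E, (S E).1 ⊆ E.1 ∧ ((∀ a ∈ s, a < n) → ∀ u : G, insert n s ⊆ (u : Finset ℕ) →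
          (∀ a ∈ (u : Finset ℕ), a ∉ insert n s →
            (∀ b ∈ insert n s, b < a) ∧ a ∈ (S E).1) → c u = κ E) := fun n => by
      by_cases hn : ∀ a ∈ s, a < n
      · obtain ⟨S, κ, hS, hκ, h⟩ := ih (insert n s) ⟨⟨n, hn, rfl⟩, hs⟩
        exact ⟨S, κ, hS, hκ, fun E => ⟨(h E).1, fun _ => (h E).2⟩⟩
      -- Here `insert n s` is not an end extension and the claim is vacuous; any color will do.
      · obtain ⟨g, hg, -⟩ := hG.exists_initialSegment _ Set.infinite_univ
        exact ⟨id, fun _ => c ⟨g, hg⟩, measurable_id, measurable_const,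
          fun E => ⟨Subset.rfl, fun h => absurd h hn⟩⟩
    choose S κ hS hκ h using ih'
    obtain ⟨S', κ', hS', hκ', h'⟩ :=
      exists_measurable_diagonal S κ hS hκ fun n E => (h n E).1
    refine ⟨S', κ', hS', hκ', fun E => ⟨(h' E).1, fun u hsu hu => ?_⟩⟩
    have hne : ((u : Finset ℕ) \ s).Nonempty := by
      rw [Finset.sdiff_nonempty]
      intro hus
      refine hs ⟨u, u.2, s.sup Nat.succ, ?_⟩
      rw [hus.antisymm hsu, eq_comm, Set.inter_eq_left]
      exact fun a ha => Nat.lt_of_succ_le (Finset.le_sup (f := Nat.succ) ha)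
    -- The least new element of `u` decides which stem applies.
    obtain ⟨n, hn, hmin⟩ := Finset.exists_min_image _ id hne
    obtain ⟨hnu, hns⟩ := Finset.mem_sdiff.1 hn
    obtain ⟨E', hE', hsubE'⟩ := (h' E).2 n (hu n hnu hns).2
    rw [← hE']
    refine (h n E').2 (hu n hnu hns).1 u (Finset.insert_subset hnu hsu) fun a ha hans => ?_
    rw [Finset.mem_insert, not_or] at hans
    have hna : n < a :=
      lt_of_le_of_ne (hmin a (Finset.mem_sdiff.2 ⟨ha, hans.2⟩)) (Ne.symm hans.1)
    refine ⟨fun b hb => ?_, hsubE' ⟨(hu a ha hans.2).2, hna⟩⟩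
    rcases Finset.mem_insert.1 hb with rfl | hb
    · exact hna
    · exact (hu a ha hans.2).1 b hb

theorem IsFront.hasBorelSelector_hom {G : Set (Finset ℕ)} (hG : IsFront G) {r : ℕ}
    (c : G → Fin r) : HasBorelSelector (hom c) := by
  obtain ⟨S, κ, hS, -, h⟩ := hG.exists_measurable_homogeneous c ∅
  refine ⟨S, hS, fun E => ⟨(h E).1, Set.mem_iUnion.2 ⟨κ E, fun u hu => ?_⟩⟩⟩
  exact (h E).2 u (Finset.empty_subset _) fun a ha _ => ⟨by simp, hu ha⟩

theorem IsCColoringIdeal.hasBorelSelector {J : Set (Set ℕ)} (hJ : IsCColoringIdeal J) :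
    HasBorelSelector J := by
  obtain ⟨G, r, c, hG, rfl⟩ := hJ
  obtain ⟨S, hS, h⟩ := hG.hasBorelSelector_hom c
  exact ⟨S, hS, fun E => ⟨(h E).1, subset_generatedIdeal _ (h E).2⟩⟩

/-! Representations in spaces of continuous functions. -/

theorem sum_abs_apply_le {K : Type*} [TopologicalSpace K] [CompactSpace K] {x : ℕ → C(K, ℝ)}
    {A : Set ℕ} {C : ℝ} (hC : ∀ F : Finset ℕ, (F : Set ℕ) ⊆ A → ‖∑ n ∈ F, x n‖ ≤ C) (k : K)
    (F : Finset ℕ) (hF : (F : Set ℕ) ⊆ A) : ∑ n ∈ F, |x n k| ≤ 2 * C := by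
  have key : ∀ F : Finset ℕ, (F : Set ℕ) ⊆ A → |∑ n ∈ F, x n k| ≤ C := fun F hF => by
    have h := (ContinuousMap.norm_coe_le_norm (∑ n ∈ F, x n) k).trans (hC F hF)
    rwa [ContinuousMap.sum_apply, Real.norm_eq_abs] at h
  have hsub : ∀ p : ℕ → Prop, ∀ [DecidablePred p], ((F.filter p : Finset ℕ) : Set ℕ) ⊆ A :=
    fun p _ => (Finset.coe_subset.2 (Finset.filter_subset _ _)).trans hF
  rw [← Finset.sum_filter_add_sum_filter_not F fun n => 0 ≤ x n k]
  have h1 : ∑ n ∈ F with 0 ≤ x n k, |x n k| = ∑ n ∈ F with 0 ≤ x n k, x n k :=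
    Finset.sum_congr rfl fun n hn => abs_of_nonneg (Finset.mem_filter.1 hn).2
  have h2 : ∑ n ∈ F with ¬ 0 ≤ x n k, |x n k| = -∑ n ∈ F with ¬ 0 ≤ x n k, x n k := by
    rw [← Finset.sum_neg_distrib]
    exact Finset.sum_congr rfl fun n hn => abs_of_neg (not_le.1 (Finset.mem_filter.1 hn).2)
  rw [h1, h2]
  have h3 := (abs_le.1 (key _ (hsub fun n => 0 ≤ x n k))).2
  have h4 := (abs_le.1 (key _ (hsub fun n => ¬ 0 ≤ x n k))).1
  linarith

/-! ### Pointwise convergence and the common level function. -/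

theorem tendsto_apply_of_isTall {K : Type*} [TopologicalSpace K] [CompactSpace K]
    {x : ℕ → C(K, ℝ)} (htall : IsTall (BIdeal x)) (k : K) :
    Tendsto (fun n => x n k) atTop (𝓝 0) := by
  rw [Metric.tendsto_atTop']
  by_contra! h
  obtain ⟨ε, hε, h⟩ := h
  have hinf : {n | ε ≤ |x n k|}.Infinite := by
    refine Set.infinite_of_not_bddAbove fun ⟨b, hb⟩ => ?_
    obtain ⟨n, hn, hnε⟩ := h b
    rw [Real.dist_0_eq_abs] at hnε
    exact (hb hnε).not_gt hn
  obtain ⟨A, hA, hAinf, C, hC⟩ := htall _ hinf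
  obtain ⟨N, hN⟩ := exists_nat_gt (2 * C / ε)
  obtain ⟨F, hF, hFc⟩ := hAinf.exists_subset_card_eq N
  have h1 := sum_abs_apply_le hC k F hF
  have h2 : (F.card : ℝ) * ε ≤ ∑ n ∈ F, |x n k| := by
    rw [← nsmul_eq_mul]
    exact Finset.card_nsmul_le_sum _ _ _ fun n hn => hA (hF hn)
  rw [div_lt_iff₀ hε] at hN
  rw [hFc] at h2
  linarith

/-- Countably many null sequences are eventually dominated by `2⁻¹ ^ ℓ` for a common `ℓ` that
tends to infinity. -/
theorem exists_level {K : Type*} [Countable K] {y : K → ℕ → ℝ}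
    (hy : ∀ k, Tendsto (y k) atTop (𝓝 0)) :
    ∃ ℓ : ℕ → ℕ, Tendsto ℓ atTop atTop ∧ ∀ k, ∀ᶠ n in atTop, |y k n| < 2⁻¹ ^ ℓ n := by
  classical
  obtain ⟨e, he⟩ := Countable.exists_injective_nat K
  let P : ℕ → ℕ → Prop := fun n j => ∀ k, e k ≤ j → |y k n| < 2⁻¹ ^ j
  have hP : ∀ j, ∀ᶠ n in atTop, P n j := fun j => by
    have hfin : {k | e k ≤ j}.Finite := (Set.finite_Iic j).preimage he.injOn
    refine (hfin.eventually_all (l := atTop) (p := fun k n => |y k n| < 2⁻¹ ^ j)).2 fun k _ => ?_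
    have h := (hy k).abs
    rw [abs_zero] at h
    exact h.eventually_lt_const (by positivity)
  -- The cap `n` makes the search finite.
  let ℓ : ℕ → ℕ := fun n => Nat.findGreatest (P n) n
  have hℓ : Tendsto ℓ atTop atTop := tendsto_atTop.2 fun j => by
    filter_upwards [hP j, eventually_ge_atTop j] with n hn hjn
    exact Nat.le_findGreatest hjn hn
  refine ⟨ℓ, hℓ, fun k => ?_⟩
  -- `Nat.findGreatest` defaults to `0`, so only a nonzero value certifies `P`.
  filter_upwards [hℓ.eventually_ge_atTop (max (e k) 1)] with n hn
  have h0 : ℓ n ≠ 0 := by have := le_max_right (e k) 1; omega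
  exact Nat.findGreatest_of_ne_zero (P := P n) rfl h0 k ((le_max_left _ _).trans hn)

theorem finite_fiber_of_tendsto {ℓ : ℕ → ℕ} (hℓ : Tendsto ℓ atTop atTop) (j : ℕ) :
    (ℓ ⁻¹' {j}).Finite := by
  have h := hℓ.eventually_gt_atTop j
  rw [← Nat.cofinite_eq_atTop] at h
  refine Set.Finite.subset h fun n hn => ?_
  have : ℓ n = j := hn
  simp [this]

theorem exists_infinite_injOn_of_tendsto {E : Set ℕ} (hE : E.Infinite) {ℓ : ℕ → ℕ}
    (hℓ : Tendsto ℓ atTop atTop) : ∃ E' ⊆ E, E'.Infinite ∧ Set.InjOn ℓ E' := by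
  obtain ⟨E', hE', hbij⟩ := Set.exists_subset_bijOn E ℓ
  refine ⟨E', hE', fun hfin => hE ?_, hbij.injOn⟩
  have h1 : (ℓ '' E).Finite := hbij.image_eq ▸ hfin.image ℓ
  exact (h1.preimage' fun j _ => finite_fiber_of_tendsto hℓ j).subset (Set.subset_preimage_image ℓ E)

/-- The coordinates at which `x · k` exceeds the threshold given by `ℓ`, and the fibers of `ℓ`. -/
def levelSets {K : Type*} [TopologicalSpace K] (x : ℕ → C(K, ℝ)) (ℓ : ℕ → ℕ) : K ⊕ ℕ → Set ℕ
  | .inl k => {n | 2⁻¹ ^ ℓ n ≤ |x n k|}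
  | .inr j => ℓ ⁻¹' {j}

/-- The measures with weights `|x n k|`, and the counting measure, on the sets `levelSets`. -/
noncomputable def levelMeasure {K : Type*} [TopologicalSpace K] (x : ℕ → C(K, ℝ)) (ℓ : ℕ → ℕ)
    (i : K ⊕ ℕ) : Measure ℕ :=
  (i.elim (fun k => Measure.count.withDensity fun n => ‖x n k‖ₑ) fun _ => Measure.count).restrict
    (levelSets x ℓ i)

/-! ### The truncated measures and their ideal. -/

theorem levelMeasure_compl {K : Type*} [TopologicalSpace K] (x : ℕ → C(K, ℝ)) (ℓ : ℕ → ℕ)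
    (i : K ⊕ ℕ) : levelMeasure x ℓ i (levelSets x ℓ i)ᶜ = 0 := by
  simp [levelMeasure, Measure.restrict_apply (MeasurableSet.of_discrete)]

theorem levelMeasure_inl {K : Type*} [TopologicalSpace K] (x : ℕ → C(K, ℝ)) (ℓ : ℕ → ℕ)
    (k : K) (A : Set ℕ) : levelMeasure x ℓ (.inl k) A =
      ∑' n, (A ∩ levelSets x ℓ (.inl k)).indicator (fun n => ‖x n k‖ₑ) n := by
  rw [levelMeasure, Measure.restrict_apply MeasurableSet.of_discrete, Sum.elim_inl,
    withDensity_apply _ MeasurableSet.of_discrete, ← lintegral_indicator MeasurableSet.of_discrete,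
    lintegral_count]

theorem levelMeasure_inr {K : Type*} [TopologicalSpace K] (x : ℕ → C(K, ℝ)) (ℓ : ℕ → ℕ)
    (j : ℕ) (A : Set ℕ) : levelMeasure x ℓ (.inr j) A = (A ∩ ℓ ⁻¹' {j}).encard := by
  rw [levelMeasure, Measure.restrict_apply MeasurableSet.of_discrete, Sum.elim_inr,
    Measure.count_apply MeasurableSet.of_discrete]
  rfl

/-- If every finite subset of `A` lay in some carrier `levelSets x ℓ (.inl k)`, compactness would
give one `k` whose finite carrier contains `A`. Two points of `A` on different levels rule out the
fibers. -/
theorem levelSets_compact {K : Type*} [TopologicalSpace K] [CompactSpace K] {x : ℕ → C(K, ℝ)}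
    {ℓ : ℕ → ℕ} (hℓ : Tendsto ℓ atTop atTop)
    (hx : ∀ k, ∀ᶠ n in atTop, |x n k| < 2⁻¹ ^ ℓ n) (A : Set ℕ) (hA : A.Infinite) :
    ∃ F : Finset ℕ, (F : Set ℕ) ⊆ A ∧ ∀ i, ¬ (F : Set ℕ) ⊆ levelSets x ℓ i := by
  classical
  have hfin : ∀ k, (levelSets x ℓ (.inl k)).Finite := fun k => by
    have h := hx k
    rw [← Nat.cofinite_eq_atTop] at h
    refine Set.Finite.subset h fun n hn => ?_
    have hn' : 2⁻¹ ^ ℓ n ≤ |x n k| := hn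
    simpa using hn'
  obtain ⟨F₀, hF₀, hF₀T⟩ : ∃ F : Finset ℕ, (F : Set ℕ) ⊆ A ∧
      ∀ k, ¬ (F : Set ℕ) ⊆ levelSets x ℓ (.inl k) := by
    by_contra! h
    have hne : (⋂ n : A, {k | 2⁻¹ ^ ℓ n ≤ |x n k|}).Nonempty := by
      refine CompactSpace.iInter_nonempty (fun n => ?_) fun u => ?_
      · exact isClosed_le continuous_const (x n).continuous.abs
      · obtain ⟨k, hk⟩ := h (u.map (Function.Embedding.subtype _)) (by simp)
        refine ⟨k, Set.mem_iInter₂.2 fun n hn => hk ?_⟩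
        exact Finset.mem_coe.2 (Finset.mem_map.2 ⟨n, hn, rfl⟩)
    obtain ⟨k, hk⟩ := hne
    exact hA ((hfin k).subset fun n hn => Set.mem_iInter.1 hk ⟨n, hn⟩)
  obtain ⟨a, ha⟩ := hA.nonempty
  obtain ⟨b, hb, hba⟩ := (hA.sdiff (finite_fiber_of_tendsto hℓ (ℓ a))).nonempty
  refine ⟨F₀ ∪ {a, b}, ?_, ?_⟩
  · simp [hF₀, Set.insert_subset_iff, ha, hb]
  · rintro (k | j) h
    · exact hF₀T k ((Finset.coe_subset.2 Finset.subset_union_left).trans h)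
    · have h1 : ℓ a = j := h (by simp)
      have h2 : ℓ b = j := h (by simp)
      exact hba (h2.trans h1.symm)

theorem iSup_levelMeasure_singleton_lt_top {K : Type*} [TopologicalSpace K] [CompactSpace K]
    (x : ℕ → C(K, ℝ)) (ℓ : ℕ → ℕ) (n : ℕ) : ⨆ i, levelMeasure x ℓ i {n} < ∞ := by
  refine (iSup_le fun i => ?_ : _ ≤ max ‖x n‖ₑ 1).trans_lt (max_lt enorm_lt_top ENNReal.one_lt_top)
  rcases i with k | j
  · refine le_max_of_le_left ?_
    rw [levelMeasure, Sum.elim_inl]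
    refine (Measure.restrict_apply_le _ _).trans ?_
    rw [withDensity_apply _ MeasurableSet.of_discrete, Measure.restrict_singleton]
    simp only [Measure.count_singleton, one_smul, lintegral_dirac]
    rw [enorm_le_iff_norm_le]
    exact ContinuousMap.norm_coe_le_norm (x n) k
  · refine le_max_of_le_right ?_
    rw [levelMeasure, Sum.elim_inr]
    exact (Measure.restrict_apply_le _ _).trans (Measure.count_singleton n).le

/-- Above threshold the weights sum to at most `C`. Below it, `A` has at most `C` points on level
`j`, each of weight at most `2⁻¹ ^ j`, adding at most `C * 2`. -/
theorem finIdeal_levelMeasure_subset {K : Type*} [TopologicalSpace K] [CompactSpace K]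
    (x : ℕ → C(K, ℝ)) (ℓ : ℕ → ℕ) :
    (finIdeal fun A => ⨆ i, levelMeasure x ℓ i A) ⊆ BIdeal x := by
  classical
  intro A hA
  set C : ℝ≥0∞ := ⨆ i, levelMeasure x ℓ i A
  have hC : C < ∞ := hA
  have hbound : ∀ k, ∀ F : Finset ℕ, (F : Set ℕ) ⊆ A → ∑ n ∈ F, ‖x n k‖ₑ ≤ C + C * 2 := by
    intro k F hF
    have hlevel : ∑ n ∈ F, (2⁻¹ : ℝ≥0∞) ^ ℓ n ≤ C * 2 := by
      rw [← Finset.sum_fiberwise_of_maps_to (t := F.image ℓ) fun n hn => Finset.mem_image_of_mem ℓ hn]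
      calc ∑ j ∈ F.image ℓ, ∑ n ∈ F with ℓ n = j, (2⁻¹ : ℝ≥0∞) ^ ℓ n
          ≤ ∑ j ∈ F.image ℓ, C * 2⁻¹ ^ j := by
            refine Finset.sum_le_sum fun j _ => ?_
            rw [Finset.sum_congr rfl fun n hn => by rw [(Finset.mem_filter.1 hn).2],
              Finset.sum_const, nsmul_eq_mul]
            gcongr
            refine le_trans ?_ (le_iSup (fun i => levelMeasure x ℓ i A) (.inr j))
            rw [levelMeasure_inr, ← ENat.toENNReal_coe, ← Set.encard_coe_eq_coe_finsetCard]
            refine ENat.toENNReal_mono (Set.encard_le_encard fun n hn => ?_)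
            have hn' := Finset.mem_filter.1 (Finset.mem_coe.1 hn)
            exact ⟨hF hn'.1, hn'.2⟩
        _ ≤ ∑' j, C * 2⁻¹ ^ j := ENNReal.sum_le_tsum _
        _ = C * 2 := by
            rw [ENNReal.tsum_mul_left, ENNReal.tsum_geometric, ENNReal.one_sub_inv_two, inv_inv]
    rw [← Finset.sum_filter_add_sum_filter_not F fun n => n ∈ levelSets x ℓ (.inl k)]
    refine add_le_add ?_ (le_trans ?_ ((Finset.sum_le_sum_of_subset
      (Finset.filter_subset (fun n => n ∉ levelSets x ℓ (.inl k)) F)).trans hlevel))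
    · refine le_trans ?_ (le_iSup (fun i => levelMeasure x ℓ i A) (.inl k))
      rw [levelMeasure_inl]
      refine le_trans (le_of_eq (Finset.sum_congr rfl fun n hn => ?_)) (ENNReal.sum_le_tsum _)
      have hn' := Finset.mem_filter.1 hn
      exact (Set.indicator_of_mem (s := A ∩ levelSets x ℓ (.inl k))
        ⟨hF hn'.1, hn'.2⟩ fun n => ‖x n k‖ₑ).symm
    · refine Finset.sum_le_sum fun n hn => ?_
      have h : |x n k| < 2⁻¹ ^ ℓ n := not_le.1 (Finset.mem_filter.1 hn).2
      rw [← ofReal_norm, Real.norm_eq_abs]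
      refine (ENNReal.ofReal_le_ofReal h.le).trans (le_of_eq ?_)
      rw [ENNReal.ofReal_pow (by norm_num), ENNReal.ofReal_inv_of_pos (by norm_num),
        ENNReal.ofReal_ofNat]
  have hfin : C + C * 2 ≠ ∞ := by
    have := hC.ne
    finiteness
  refine ⟨(C + C * 2).toReal, fun F hF => ?_⟩
  rw [ContinuousMap.norm_le _ ENNReal.toReal_nonneg]
  intro k
  rw [ContinuousMap.sum_apply, ← toReal_enorm]
  exact ENNReal.toReal_mono hfin ((enorm_sum_le _ _).trans (hbound k F hF))

/-- Thin `E` so that `ℓ` is injective before using tallness: every fiber then counts at most `1`,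
and the weighted sums are at most `2 * C`. -/
theorem isTall_finIdeal_levelMeasure {K : Type*} [TopologicalSpace K] [CompactSpace K]
    {x : ℕ → C(K, ℝ)} (htall : IsTall (BIdeal x)) {ℓ : ℕ → ℕ} (hℓ : Tendsto ℓ atTop atTop) :
    IsTall (finIdeal fun A => ⨆ i, levelMeasure x ℓ i A) := by
  intro E hE
  obtain ⟨E', hE'E, hE', hinj⟩ := exists_infinite_injOn_of_tendsto hE hℓ
  obtain ⟨A, hAE', hA, C, hC⟩ := htall E' hE'
  refine ⟨A, hAE'.trans hE'E, hA, ?_⟩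
  refine (iSup_le fun i => ?_ : _ ≤ max (ENNReal.ofReal (2 * C)) 1).trans_lt
    (max_lt ENNReal.ofReal_lt_top ENNReal.one_lt_top)
  rcases i with k | j
  · classical
    refine le_max_of_le_left ?_
    rw [levelMeasure_inl]
    refine ENNReal.tsum_le_of_sum_range_le fun N => ?_
    rw [← Finset.sum_filter_add_sum_filter_not _ fun n => n ∈ A]
    rw [Finset.sum_eq_zero (s := (Finset.range N).filter fun n => n ∉ A) fun n hn =>
      Set.indicator_of_notMem (fun h => (Finset.mem_filter.1 hn).2 h.1) _, add_zero]
    have h := sum_abs_apply_le hC k ((Finset.range N).filter fun n => n ∈ A) fun n hn =>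
      (Finset.mem_filter.1 (Finset.mem_coe.1 hn)).2
    refine le_trans (Finset.sum_le_sum fun n _ => Set.indicator_le_self' (fun _ _ => zero_le) n) ?_
    refine le_trans (le_of_eq ?_) (ENNReal.ofReal_le_ofReal h)
    rw [ENNReal.ofReal_sum_of_nonneg fun _ _ => abs_nonneg _]
    exact Finset.sum_congr rfl fun n _ => by rw [← ofReal_norm, Real.norm_eq_abs]
  · refine le_max_of_le_right ?_
    rw [levelMeasure_inr, ← ENat.toENNReal_one]
    refine ENat.toENNReal_mono (Set.encard_le_one_iff.2 fun a b ha hb => ?_)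
    exact hinj (hAE' ha.1) (hAE' hb.1) ((show ℓ a = j from ha.2).trans (show ℓ b = j from hb.2).symm)

end CColoring

theorem mainTheorem1 {K : Type*} [TopologicalSpace K] [CompactSpace K] [T2Space K] [Countable K]
    (I : Set (Set ℕ)) (hI : CColoring.IsSetIdeal I) (htall : CColoring.IsTall I)
    (hrep : CColoring.IsBRepresentable C(K, ℝ) I) :
    (∃ J : Set (Set ℕ), CColoring.IsCColoringIdeal J ∧ CColoring.IsNonpathological J ∧ J ⊆ I) ∧
      CColoring.HasBorelSelector I := by
  obtain ⟨x, rfl⟩ := hrep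
  obtain ⟨ℓ, hℓ, hx⟩ := CColoring.exists_level fun k => CColoring.tendsto_apply_of_isTall htall k
  have hsing := CColoring.iSup_levelMeasure_singleton_lt_top x ℓ
  have hJ := CColoring.isCColoringIdeal_finIdeal (CColoring.levelSets_compact hℓ hx)
    (CColoring.levelMeasure_compl x ℓ) hsing (CColoring.isTall_finIdeal_levelMeasure htall hℓ)
  have hsub := CColoring.finIdeal_levelMeasure_subset x ℓ
  refine ⟨⟨_, hJ, ⟨_, CColoring.isLSCSubmeasure_iSup_measure _ hsing,
    CColoring.isSupOfMeasures_iSup_measure _, rfl⟩, hsub⟩, ?_⟩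
  obtain ⟨S, hS, h⟩ := hJ.hasBorelSelector
  exact ⟨S, hS, fun E => ⟨(h E).1, hsub (h E).2⟩⟩
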